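/- Let $\mathcal G=(V,E)$ be a directed acyclic network with finitely many edges; each edge $e$ is directed from $\mathrm{tail}(e)$ to $\mathrm{head}(e)$ and carries at most one symbol per time slot. Let three unicast sessions be given, the $i$th ($i=1,2,3$) with sender $s_i$ and receiver $d_i$, such that $s_i$ has no incoming edge and exactly one outgoing edge $\sigma_i$, and $d_i$ has no outgoing edge and exactly one incoming edge $\tau_i$. A directed path from an edge $e$ to an edge $e'$ is a sequence of edges $e_1,\dots,e_k$ with $e_1=e$, $e_k=e'$ and $\mathrm{head}(e_l)=\mathrm{tail}(e_{l+1})$ for $1\le l<k$. With one variable $x_{ee'}$ for each pair of edges with $\mathrm{head}(e)=\mathrm{tail}(e')$, let $$m_{ji}(\mathbf x)=\sum_{(e_1,\dots,e_k)}\ \prod_{l=1}^{k-1}x_{e_le_{l+1}}\in\mathbb F_2[\mathbf x],$$ where the sum is over all directed paths from $\sigma_j$ to $\tau_i$. Assume that for all $i,j\in\{1,2,3\}$ there is a directed path from $\sigma_j$ to $\tau_i$ (so that all $m_{ji}$ are non-zero), and define the rational functions $$p_1=\frac{m_{13}m_{21}}{m_{11}m_{23}},\quad p_2=\frac{m_{13}m_{22}}{m_{12}m_{23}},\quad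 p_3=\frac{m_{21}m_{33}}{m_{23}m_{31}},\quad \eta=\frac{m_{13}m_{21}m_{32}}{m_{12}m_{23}m_{31}}$$ in $\mathbb F_2(\mathbf x)$. A routing scheme over $N\ge 1$ time slots that delivers $k_i$ packets for session $i$ ($i=1,2,3$) assigns to each edge and each slot at most one packet, such that a packet of session $i$ carried by an edge $e\ne\sigma_i$ in some slot is also carried in the same slot by some edge $e'$ with $\mathrm{head}(e')=\mathrm{tail}(e)$ (packets are only forwarded, never combined), and each packet of session $i$ is carried by $\tau_i$ in some slot. Routing achieves the rate tuple $(R_1,R_2,R_3)$ if such a scheme exists with $R_i=k_i/N$ for $i=1,2,3$. **Theorem.** If $\eta(\mathbf x)=1$ and $p_i(\mathbf x)\neq 1$ for $i=1,2,3$, then routing achieves the rate tuple $(1,1,1)$. More precisely, there are pairwise edge-disjoint directed paths $P_1,P_2,P_3$, with $P_i$ from $\sigma_i$ to $\tau_i$, and the scheme over one time slot in which the edges of $P_i$, and no other edges, carry the single packet of session $i$ is a routing scheme. -/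

import Mathlib

/-- A single-input single-output communication scenario with three unicast sessions: a directed
acyclic network with node set `V` and edge set `E` (the edge `e` goes from `tail e` to `head e`;
parallel edges are allowed) in which the sender `s i` of session `i` has no incoming edge and
`σ i` as its only outgoing edge, and the receiver `d i` has `τ i` as its only incoming edge and no
outgoing edge. Distinctness of the senders or of the receivers is not needed and not required. -/
structure SISOScenario (V E : Type*) where
  tail : E → V
  head : E → V
  acyclic : ∀ v : V, ¬ Relation.TransGen (fun u w => ∃ e : E, tail e = u ∧ head e = w) v v
  s : Fin 3 → V
  d : Fin 3 → V
  σ : Fin 3 → E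
  τ : Fin 3 → E
  sender_in : ∀ i e, head e ≠ s i
  sender_out : ∀ i e, tail e = s i ↔ e = σ i
  receiver_in : ∀ i e, head e = d i ↔ e = τ i
  receiver_out : ∀ i e, tail e ≠ d i

namespace SISOScenario

variable {V E : Type*} (G : SISOScenario V E)

/-- `P = [e₁, …, e_k]` is a directed path from the edge `a` to the edge `b`: `e₁ = a`, `e_k = b`
and `head e_i = tail e_{i+1}`. -/
def IsPath (a b : E) (P : List E) : Prop :=
  P.head? = some a ∧ P.getLast? = some b ∧ P.IsChain (fun e e' => G.head e = G.tail e')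

theorem IsPath.nodup {a b : E} {P : List E} (h : G.IsPath a b P) : P.Nodup := by
  have hlift : ∀ e e' : E, Relation.TransGen (fun e e' => G.head e = G.tail e') e e' →
      Relation.TransGen (fun u w => ∃ e : E, G.tail e = u ∧ G.head e = w)
        (G.tail e) (G.tail e') := fun e e' hee' => by
    induction hee' with
    | single h => exact .single ⟨e, rfl, h⟩
    | tail _ h ih => exact ih.tail ⟨_, rfl, h⟩
  have h1 : P.IsChain (Relation.TransGen (fun e e' => G.head e = G.tail e')) :=
    h.2.2.imp fun _ _ => Relation.TransGen.single
  refine h1.pairwise.imp ?_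
  rintro x y hxy rfl
  exact G.acyclic _ (hlift x x hxy)

theorem finite_paths [Finite E] (a b : E) : {P : List E | G.IsPath a b P}.Finite := by
  classical
  cases nonempty_fintype E
  refine (List.finite_length_le E (Fintype.card E)).subset fun P hP => ?_
  exact List.Nodup.length_le_card (IsPath.nodup G hP)

/-- The product `x_{e₁e₂} x_{e₂e₃} ⋯ x_{e_{k-1}e_k}` of the coding coefficients along a list of
edges. The variable indexed by `(e, e')` is the coefficient with which the symbol on `e` enters the
symbol on `e'`; along a path only pairs with `head e = tail e'` occur. -/
noncomputable def pathMonomial (P : List E) : MvPolynomial (E × E) (ZMod 2) :=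
  ((P.zip P.tail).map MvPolynomial.X).prod

/-- The transfer function `m_{ji}` from `σ j` to `τ i`: the sum of the path monomials over all
directed paths from `σ j` to `τ i`. -/
noncomputable def transfer [Finite E] (j i : Fin 3) : MvPolynomial (E × E) (ZMod 2) :=
  ∑ P ∈ (G.finite_paths (G.σ j) (G.τ i)).toFinset, pathMonomial P

/-- The transfer function `m_{ji}` as an element of the field of rational functions. -/
noncomputable def m [Finite E] (j i : Fin 3) : FractionRing (MvPolynomial (E × E) (ZMod 2)) :=
  algebraMap (MvPolynomial (E × E) (ZMod 2)) _ (G.transfer j i)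

/- The sessions 1, 2, 3 are the elements 0, 1, 2 of `Fin 3`. -/

noncomputable def p₁ [Finite E] : FractionRing (MvPolynomial (E × E) (ZMod 2)) :=
  (G.m 0 2 * G.m 1 0) / (G.m 0 0 * G.m 1 2)

noncomputable def p₂ [Finite E] : FractionRing (MvPolynomial (E × E) (ZMod 2)) :=
  (G.m 0 2 * G.m 1 1) / (G.m 0 1 * G.m 1 2)

noncomputable def p₃ [Finite E] : FractionRing (MvPolynomial (E × E) (ZMod 2)) :=
  (G.m 1 0 * G.m 2 2) / (G.m 1 2 * G.m 2 0)

noncomputable def η [Finite E] : FractionRing (MvPolynomial (E × E) (ZMod 2)) :=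
  (G.m 0 2 * G.m 1 0 * G.m 2 1) / (G.m 0 1 * G.m 1 2 * G.m 2 0)

/-- All the senders are connected to all the receivers via directed paths. -/
def FullyConnected : Prop :=
  ∀ j i : Fin 3, ∃ P : List E, G.IsPath (G.σ j) (G.τ i) P

/-- A routing scheme over `N` time slots in which session `i` delivers the packets
`⟨i, 0⟩, …, ⟨i, k i - 1⟩`. In each slot an edge carries at most one packet. A packet of session `i`
enters the network on `σ i`; on any other edge a packet can only be forwarded, unchanged, from an
edge entering its tail that carries it in the same slot (edges are delay-free and inner nodes have
no memory). Every packet of session `i` arrives on `τ i` in some slot. -/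
structure RoutingScheme (N : ℕ) (k : Fin 3 → ℕ) where
  carry : Fin N → E → Option (Σ i : Fin 3, Fin (k i))
  forward : ∀ t e pkt, carry t e = some pkt →
    e = G.σ pkt.1 ∨ ∃ e', G.head e' = G.tail e ∧ carry t e' = some pkt
  deliver : ∀ pkt : (Σ i : Fin 3, Fin (k i)), ∃ t, carry t (G.τ pkt.1) = some pkt

/-- Routing achieves the rate tuple `R`: for some `N ≥ 1` and `k` with `R i = k i / N`, there is a
routing scheme over `N` slots which delivers `k i` packets for each session `i`. -/
def RoutingAchieves (R : Fin 3 → ℚ) : Prop :=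
  ∃ (N : ℕ) (k : Fin 3 → ℕ), 0 < N ∧ (∀ i, R i = (k i : ℚ) / (N : ℚ)) ∧
    Nonempty (G.RoutingScheme N k)

end SISOScenario

/-!
For edges `a`, `b` let `pathSum a b` be the sum of the path monomials over all directed paths from
`a` to `b`, so that `m_{ji} = pathSum (σ j) (τ i)`. An edge `v` is a *bottleneck* from `a` to `b` if
all these paths use it; then `pathSum a b = pathSum a v * pathSum v b`. The variable indexed by the
pair `(e, e')` is said to leave `e` and to enter `e'`.

The algebraic input is a converse to this factorization
(`exists_killVars_arcsInto_eq_zero`). A path enters an edge `v` at most once, so if `h * k` is a path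
polynomial, then at most one of `h`, `k` involves the pairs entering `v`. If `h` is not constant and
`v` is the last edge entered by a pair that `h` involves, then the pairs leaving `v` occur only in
`k`. Comparing the effects on `h * k` of setting to zero the pairs that enter `v` and the pairs that
leave `v` (`MvPolynomial.killVars_left_eq_zero`), one finds that `h` vanishes when the pairs entering
`v` are set to zero. Hence so does every path polynomial divisible by `h`, and since no cancellation
occurs in sums of path monomials, `v` is a bottleneck for each of them. So two path polynomials with
the same start are coprime once the start has been moved to the last common bottleneck
(`exists_bottleneck_isRelPrime_from`), and dually for a common end
(`exists_bottleneck_isRelPrime_into`).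

For each `i` let `α i` be the last common bottleneck of the paths from `σ i` to the other sessions'
receivers, and let `β j` be the first common bottleneck of the paths from the `α i`, `i ≠ j`, to
`τ j`. With `B i j = pathSum (α i) (β j)` for `i ≠ j`, the identity `η = 1` becomes
`B 0 2 * B 1 0 * B 2 1 = B 0 1 * B 1 2 * B 2 0`, and now entries in one row or one column are coprime.
Hence `B i k` and `B k i` divide each other. A nonconstant path polynomial determines the ends of its
paths, and a constant one belongs to a trivial path; it follows that there are edges `f` and `g`,
with `g` reachable from `f`, and a session `j` such that every path between different sessions passes
through `f` unless it starts at `σ j`, and through `g` unless it ends at `τ j`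
(`exists_bottlenecks_of_cyclic_eq`).

If all paths of a session other than `j` passed through `g`, the four path polynomials in the
corresponding `p_i` would factor there and give `p_i = 1`. So this session has a path avoiding `g`;
it avoids `f` as well, because a path from another session that joined it at `f` would contain `g`
before `f`. In the same way session `j` has a path avoiding `f` if `f = g`. If paths of two different
sessions met in an edge, switching from one to the other there would give paths between different
sessions that can contain `f` and `g` only in an order that acyclicity forbids
(`exists_disjoint_paths`).
-/

/-! ### Setting variables to zero -/

namespace MvPolynomial

variable {ι R : Type*} [CommRing R]

open Classical in
/-- The substitution that sets the variables in `I` to zero and keeps the others. -/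
noncomputable def killVars (I : Set ι) : MvPolynomial ι R →ₐ[R] MvPolynomial ι R :=
  bind₁ fun i => if i ∈ I then 0 else X i

open Classical in
/-- The substitution that multiplies every variable in `I` by a new variable `T`; the degree in `T`
of the image of a polynomial is its total degree in the variables of `I`. -/
noncomputable def tagVars (I : Set ι) : MvPolynomial ι R →ₐ[R] Polynomial (MvPolynomial ι R) :=
  aeval fun i => if i ∈ I then Polynomial.C (X i) * Polynomial.X else Polynomial.C (X i)

theorem killVars_X_of_mem {I : Set ι} {i : ι} (h : i ∈ I) :
    killVars I (X i : MvPolynomial ι R) = 0 := by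
  simp [killVars, h]

theorem killVars_X_of_notMem {I : Set ι} {i : ι} (h : i ∉ I) :
    killVars I (X i : MvPolynomial ι R) = X i := by
  simp [killVars, h]

theorem killVars_comm (I J : Set ι) (p : MvPolynomial ι R) :
    killVars I (killVars J p) = killVars J (killVars I p) := by
  have : (killVars I).comp (killVars J) = (killVars J).comp (killVars (R := R) I) := by
    ext1 i
    by_cases hI : i ∈ I <;> by_cases hJ : i ∈ J <;> simp [killVars, hI, hJ]
  exact DFunLike.congr_fun this p

theorem killVars_eq_self {I : Set ι} {p : MvPolynomial ι R} (h : ∀ i ∈ p.vars, i ∉ I) :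
    killVars I p = p := by
  have := hom_congr_vars (f₁ := (killVars I : MvPolynomial ι R →ₐ[R] _).toRingHom)
    (f₂ := RingHom.id _) (p₁ := p) (p₂ := p) (by ext; simp)
    (fun i hi _ => by simpa using killVars_X_of_notMem (h i hi)) rfl
  simpa using this

theorem notMem_of_mem_vars_killVars [Nontrivial R] {I : Set ι} {p : MvPolynomial ι R} {i : ι}
    (h : i ∈ (killVars I p).vars) : i ∉ I := by
  classical
  obtain ⟨j, -, hj⟩ := mem_vars_bind₁ _ _ h
  intro hi
  split_ifs at hj with hjI
  · simp at hj
  · rw [vars_X, Finset.mem_singleton] at hj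
    exact hjI (hj ▸ hi)

theorem eval_zero_tagVars (I : Set ι) (p : MvPolynomial ι R) :
    (tagVars I p).eval 0 = killVars I p := by
  have : ((Polynomial.aeval (0 : MvPolynomial ι R)).restrictScalars R).comp (tagVars I)
      = killVars I := by
    ext1 i
    by_cases hI : i ∈ I <;> simp [tagVars, killVars, hI]
  simpa [Polynomial.aeval_def, Polynomial.eval₂_eq_eval_map] using DFunLike.congr_fun this p

theorem eval_one_tagVars (I : Set ι) (p : MvPolynomial ι R) : (tagVars I p).eval 1 = p := by
  have : ((Polynomial.aeval (1 : MvPolynomial ι R)).restrictScalars R).comp (tagVars I)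
      = AlgHom.id R _ := by
    ext1 i
    by_cases hI : i ∈ I <;> simp [tagVars, hI]
  simpa [Polynomial.aeval_def, Polynomial.eval₂_eq_eval_map] using DFunLike.congr_fun this p

theorem killVars_eq_self_of_natDegree_tagVars {I : Set ι} {p : MvPolynomial ι R}
    (h : (tagVars I p).natDegree = 0) : killVars I p = p := by
  rw [← eval_zero_tagVars]
  conv_rhs => rw [← eval_one_tagVars I p]
  rw [Polynomial.eq_C_of_natDegree_eq_zero h, Polynomial.eval_C, Polynomial.eval_C]

theorem natDegree_tagVars_mul [IsDomain R] {I : Set ι} {h k : MvPolynomial ι R}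
    (hne : h * k ≠ 0) :
    (tagVars I (h * k)).natDegree = (tagVars I h).natDegree + (tagVars I k).natDegree := by
  have tag_ne : ∀ p : MvPolynomial ι R, p ≠ 0 → tagVars I p ≠ 0 := fun p hp h0 => hp <| by
    rw [← eval_one_tagVars I p, h0, Polynomial.eval_zero]
  rw [map_mul, Polynomial.natDegree_mul (tag_ne _ (left_ne_zero_of_mul hne))
    (tag_ne _ (right_ne_zero_of_mul hne))]

theorem killVars_left_eq_self [IsDomain R] {I : Set ι} {h k : MvPolynomial ι R}
    (hne : h * k ≠ 0) (hdeg : (tagVars I (h * k)).natDegree = 0) : killVars I h = h := by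
  rw [natDegree_tagVars_mul hne] at hdeg
  exact killVars_eq_self_of_natDegree_tagVars (by omega)

/-- In a factorization of a polynomial of degree at most one in the variables of `I`, at most one
factor involves these variables. -/
theorem killVars_right_eq_self [IsDomain R] {I : Set ι} {h k : MvPolynomial ι R}
    (hne : h * k ≠ 0) (hdeg : (tagVars I (h * k)).natDegree ≤ 1) (hh : killVars I h ≠ h) :
    killVars I k = k := by
  rw [natDegree_tagVars_mul hne] at hdeg
  have h1 : (tagVars I h).natDegree ≠ 0 := fun h0 => hh (killVars_eq_self_of_natDegree_tagVars h0)
  exact killVars_eq_self_of_natDegree_tagVars (by omega)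

/-- Let `h * k` have degree at most one in the variables of `I`, and suppose that `h` involves these
variables but not those of `O`. If killing `I` or killing `O` has the same effect on `h * k`, or if
killing `I` kills `h * k`, then it kills already `h`. -/
theorem killVars_left_eq_zero [IsDomain R] {I O : Set ι} {h k : MvPolynomial ι R}
    (hne : h * k ≠ 0) (hdeg : (tagVars I (h * k)).natDegree ≤ 1) (hI : killVars I h ≠ h)
    (hO : killVars O h = h)
    (hm : killVars I (h * k) = 0 ∨ killVars O (h * k) = killVars I (h * k)) :
    killVars I h = 0 := by
  have hk : killVars I k = k := killVars_right_eq_self hne hdeg hI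
  have hk0 : k ≠ 0 := right_ne_zero_of_mul hne
  rcases hm with hm | hm
  · rw [map_mul, hk] at hm
    exact (mul_eq_zero.1 hm).resolve_right hk0
  · rw [map_mul, map_mul, hO, hk] at hm
    -- Killing `I` once more changes the left side only in the factor `h`.
    have h2 : killVars I h * killVars O k = killVars I h * k := by
      have := congrArg (killVars I) hm
      rw [map_mul, map_mul, killVars_comm I O k, hk] at this
      rw [this]
      congr 1
      have idem : (killVars I).comp (killVars I) = killVars (R := R) I := by
        ext1 i
        by_cases hi : i ∈ I <;> simp [killVars, hi]
      exact DFunLike.congr_fun idem h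
    have h3 : (h - killVars I h) * killVars O k = 0 := by rw [sub_mul, hm, h2, sub_self]
    have h4 : killVars O k = 0 :=
      (mul_eq_zero.1 h3).resolve_left (sub_ne_zero.2 (Ne.symm hI))
    rw [h4, mul_zero] at hm
    exact (mul_eq_zero.1 hm.symm).resolve_right hk0

end MvPolynomial

/-! ### Path monomials -/

namespace SISOScenario

open MvPolynomial

variable {E : Type*}

@[simp] theorem pathMonomial_singleton (a : E) : pathMonomial [a] = 1 := by
  simp [pathMonomial]

@[simp] theorem pathMonomial_cons_cons (a b : E) (l : List E) :
    pathMonomial (a :: b :: l) = X (a, b) * pathMonomial (b :: l) := by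
  simp [pathMonomial]

theorem pathMonomial_append (s t : List E) (v : E) :
    pathMonomial (s ++ v :: t) = pathMonomial (s ++ [v]) * pathMonomial (v :: t) := by
  induction s with
  | nil => simp
  | cons a s ih => cases s with
    | nil => simp
    | cons b s => simp only [List.cons_append, pathMonomial_cons_cons] at ih ⊢; rw [ih, mul_assoc]

theorem exists_pathMonomial_eq_monomial (P : List E) : ∃ s, pathMonomial P = monomial s 1 := by
  unfold pathMonomial
  induction P.zip P.tail with
  | nil => exact ⟨0, rfl⟩
  | cons x l ih =>
    obtain ⟨s, hs⟩ := ih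
    exact ⟨Finsupp.single x 1 + s, by simp [hs, X, monomial_mul]⟩

theorem pathMonomial_ne_zero (P : List E) : pathMonomial P ≠ 0 := by
  obtain ⟨s, hs⟩ := exists_pathMonomial_eq_monomial P
  simp [hs]

theorem killVars_pathMonomial_of_forall {I : Set (E × E)} {P : List E}
    (h : ∀ x ∈ P.zip P.tail, x ∉ I) : killVars I (pathMonomial P) = pathMonomial P := by
  unfold pathMonomial
  rw [map_list_prod, List.map_map]
  congr 1
  exact List.map_congr_left fun x hx => killVars_X_of_notMem (h x hx)

theorem killVars_pathMonomial_of_mem {I : Set (E × E)} {P : List E} {x : E × E}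
    (hx : x ∈ P.zip P.tail) (hI : x ∈ I) : killVars I (pathMonomial P) = 0 := by
  unfold pathMonomial
  rw [map_list_prod, List.map_map]
  exact List.prod_eq_zero (List.mem_map.2 ⟨x, hx, killVars_X_of_mem hI⟩)

/-- The variables of the pairs `(e, v)`. -/
def arcsInto (v : E) : Set (E × E) := {x | x.2 = v}

/-- The variables of the pairs `(v, e)`. -/
def arcsFrom (v : E) : Set (E × E) := {x | x.1 = v}

/-- A duplicate-free list of edges is determined by its first edge and its path monomial. -/
theorem eq_of_pathMonomial_eq {a : E} {P Q : List E} (hP : (a :: P).Nodup) (hQ : (a :: Q).Nodup)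
    (h : pathMonomial (a :: P) = pathMonomial (a :: Q)) : P = Q := by
  induction P generalizing a Q with
  | nil => cases Q with
    | nil => rfl
    | cons c Q =>
      have := congrArg (killVars {(a, c)}) h
      simp [killVars_X_of_mem] at this
  | cons b P ih => cases Q with
    | nil =>
      have := congrArg (killVars {(a, b)}) h
      simp [killVars_X_of_mem] at this
    | cons c Q =>
      rw [pathMonomial_cons_cons, pathMonomial_cons_cons] at h
      have hbc : b = c := by
        by_contra hbc
        -- Since `a` does not occur again, `x_{ab}` is not a variable of the right side.
        have h1 := congrArg (killVars {(a, b)}) h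
        rw [map_mul, map_mul, killVars_X_of_mem (Set.mem_singleton _),
          killVars_X_of_notMem (by simpa using Ne.symm hbc),
          killVars_pathMonomial_of_forall (P := c :: Q), zero_mul] at h1
        · exact mul_ne_zero (X_ne_zero _) (pathMonomial_ne_zero _) h1.symm
        · rintro ⟨u, w⟩ hx hu
          obtain rfl : u = a := congrArg Prod.fst hu
          exact (List.nodup_cons.1 hQ).1 (List.of_mem_zip hx).1
      subst hbc
      rw [ih hP.of_cons hQ.of_cons (mul_left_cancel₀ (X_ne_zero _) h)]

theorem exists_mem_zip_tail_right {P : List E} {v : E} (h : v ∈ P.tail) :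
    ∃ u, (u, v) ∈ P.zip P.tail := by
  induction P with
  | nil => simp at h
  | cons a P ih => cases P with
    | nil => simp at h
    | cons b P =>
      rcases List.mem_cons.1 h with rfl | h
      · exact ⟨a, by simp⟩
      · obtain ⟨u, hu⟩ := ih h
        exact ⟨u, List.mem_cons_of_mem _ hu⟩

theorem exists_mem_zip_tail_left {P : List E} {v : E} (h : v ∈ P.dropLast) :
    ∃ w, (v, w) ∈ P.zip P.tail := by
  induction P with
  | nil => simp at h
  | cons a P ih => cases P with
    | nil => simp at h
    | cons b P =>
      rcases List.mem_cons.1 h with rfl | h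
      · exact ⟨b, by simp⟩
      · obtain ⟨w, hw⟩ := ih h
        exact ⟨w, List.mem_cons_of_mem _ hw⟩

theorem rel_of_mem_zip_tail {r : E → E → Prop} {P : List E} (hP : P.IsChain r) {x : E × E}
    (hx : x ∈ P.zip P.tail) : r x.1 x.2 := by
  induction P with
  | nil => simp at hx
  | cons a P ih => cases P with
    | nil => simp at hx
    | cons b P =>
      rw [List.isChain_cons_cons] at hP
      rcases List.mem_cons.1 hx with rfl | hx
      · exact hP.1
      · exact ih hP.2 hx

theorem killVars_arcsInto {P : List E} {v : E} (h : v ∉ P.tail) :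
    killVars (arcsInto v) (pathMonomial P) = pathMonomial P :=
  killVars_pathMonomial_of_forall fun _ hx hv => h (hv ▸ (List.of_mem_zip hx).2)

theorem killVars_arcsInto_eq_zero {P : List E} {v : E} (h : v ∈ P.tail) :
    killVars (arcsInto v) (pathMonomial P) = 0 := by
  obtain ⟨u, hu⟩ := exists_mem_zip_tail_right h
  exact killVars_pathMonomial_of_mem hu rfl

theorem mem_dropLast_of_mem_zip_tail {P : List E} {x : E × E} (hx : x ∈ P.zip P.tail) :
    x.1 ∈ P.dropLast := by
  induction P with
  | nil => simp at hx
  | cons a P ih => cases P with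
    | nil => simp at hx
    | cons b P =>
      rcases List.mem_cons.1 hx with rfl | hx
      · simp
      · exact List.mem_cons_of_mem _ (ih hx)

theorem killVars_arcsFrom {P : List E} {v : E} (h : v ∉ P.dropLast) :
    killVars (arcsFrom v) (pathMonomial P) = pathMonomial P :=
  killVars_pathMonomial_of_forall fun _ hx hv => h (hv ▸ mem_dropLast_of_mem_zip_tail hx)

theorem killVars_arcsFrom_eq_zero {P : List E} {v : E} (h : v ∈ P.dropLast) :
    killVars (arcsFrom v) (pathMonomial P) = 0 := by
  obtain ⟨w, hw⟩ := exists_mem_zip_tail_left h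
  exact killVars_pathMonomial_of_mem hw rfl

theorem tagVars_pathMonomial_of_forall {I : Set (E × E)} {P : List E}
    (h : ∀ x ∈ P.zip P.tail, x ∉ I) :
    (tagVars I (pathMonomial P)).natDegree = 0 := by
  have : tagVars I (pathMonomial P) = Polynomial.C (pathMonomial P) := by
    unfold pathMonomial
    rw [map_list_prod, map_list_prod, List.map_map, List.map_map]
    congr 1
    exact List.map_congr_left fun x hx => by simp [tagVars, h x hx]
  rw [this, Polynomial.natDegree_C]

theorem natDegree_tagVars_X_le (I : Set (E × E)) (x : E × E) :
    (tagVars I (X x : MvPolynomial (E × E) (ZMod 2))).natDegree ≤ 1 := by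
  by_cases hx : x ∈ I
  · simp [tagVars, hx]
  · simp [tagVars, hx]

/-- A path uses at most one of the pairs in `I` if after such a pair it cannot use another one. -/
theorem natDegree_tagVars_pathMonomial_le {I : Set (E × E)} {P : List E}
    (h : (P.zip P.tail).Pairwise fun x y => x ∈ I → y ∉ I) :
    (tagVars I (pathMonomial P)).natDegree ≤ 1 := by
  induction P with
  | nil => simp [pathMonomial]
  | cons a P ih => cases P with
    | nil => simp
    | cons b P =>
      obtain ⟨h1, h2⟩ : (∀ y ∈ (b :: P).zip P, (a, b) ∈ I → y ∉ I) ∧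
          ((b :: P).zip P).Pairwise fun x y => x ∈ I → y ∉ I := by simpa using h
      rw [pathMonomial_cons_cons, map_mul]
      refine Polynomial.natDegree_mul_le.trans ?_
      by_cases hab : (a, b) ∈ I
      · rw [tagVars_pathMonomial_of_forall (P := b :: P) fun y hy => h1 y hy hab]
        exact natDegree_tagVars_X_le I _
      · have : (tagVars I (X (a, b) : MvPolynomial (E × E) (ZMod 2))).natDegree = 0 := by
          simp [tagVars, hab]
        rw [this, zero_add]
        exact ih h2

theorem pairwise_zip_tail {P : List E} (hP : P.Nodup) :
    (P.zip P.tail).Pairwise fun x y => x.1 ≠ y.1 ∧ x.2 ≠ y.2 := by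
  induction P with
  | nil => simp
  | cons a P ih => cases P with
    | nil => simp
    | cons b P =>
      obtain ⟨h1, h2⟩ := List.nodup_cons.1 hP
      refine List.pairwise_cons.2 ⟨fun y hy => ⟨?_, ?_⟩, ih h2⟩
      · rintro rfl
        exact h1 (List.of_mem_zip hy).1
      · intro hb
        refine (List.nodup_cons.1 h2).1 ?_
        change b = y.2 at hb
        exact hb ▸ (List.of_mem_zip (l₁ := b :: P) (l₂ := P) hy).2

theorem natDegree_tagVars_arcsInto_le {P : List E} (hP : P.Nodup) (v : E) :
    (tagVars (arcsInto v) (pathMonomial P)).natDegree ≤ 1 :=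
  natDegree_tagVars_pathMonomial_le <| (pairwise_zip_tail hP).imp fun h hx hy =>
    h.2 (Eq.trans hx (Eq.symm hy))

theorem natDegree_tagVars_arcsFrom_le {P : List E} (hP : P.Nodup) (v : E) :
    (tagVars (arcsFrom v) (pathMonomial P)).natDegree ≤ 1 :=
  natDegree_tagVars_pathMonomial_le <| (pairwise_zip_tail hP).imp fun h hx hy =>
    h.1 (Eq.trans hx (Eq.symm hy))

end SISOScenario

/-! ### Directed paths -/

namespace SISOScenario

open MvPolynomial

variable {V E : Type*} (G : SISOScenario V E)

/-- The relation "some directed path leads from `a` to `b`". -/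
def Reaches (a b : E) : Prop := ∃ P, G.IsPath a b P

/-- The edge `v` is a bottleneck from `a` to `b`: every directed path from `a` to `b` uses it. -/
def Bottleneck (a b v : E) : Prop := ∀ P, G.IsPath a b P → v ∈ P

variable {G}

theorem isPath_append_cons {a b v : E} {s t : List E} :
    G.IsPath a b (s ++ v :: t) ↔ G.IsPath a v (s ++ [v]) ∧ G.IsPath v b (v :: t) := by
  unfold IsPath
  have h1 : (s ++ v :: t).getLast? = (v :: t).getLast? := by
    rw [List.getLast?_append, List.getLast?_cons, Option.some_or]
  have h2 : (s ++ [v]).getLast? = some v := by simp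
  rw [List.isChain_split, h1, h2]
  cases s with
  | nil => simp
  | cons c s => simp; tauto

theorem isPath_singleton (a : E) : G.IsPath a a [a] := by simp [IsPath]

theorem IsPath.exists_eq_cons {a b : E} {P : List E} (h : G.IsPath a b P) : ∃ t, P = a :: t :=
  List.head?_eq_some_iff.1 h.1

theorem IsPath.exists_eq_concat {a b : E} {P : List E} (h : G.IsPath a b P) :
    ∃ s, P = s ++ [b] :=
  List.getLast?_eq_some_iff.1 h.2.1

theorem IsPath.left_mem {a b : E} {P : List E} (h : G.IsPath a b P) : a ∈ P := by
  obtain ⟨t, rfl⟩ := h.exists_eq_cons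
  simp

theorem IsPath.right_mem {a b : E} {P : List E} (h : G.IsPath a b P) : b ∈ P := by
  obtain ⟨t, rfl⟩ := h.exists_eq_concat
  simp

theorem IsPath.split {a b v : E} {P : List E} (h : G.IsPath a b P) (hv : v ∈ P) :
    ∃ P₁ P₂, G.IsPath a v P₁ ∧ G.IsPath v b P₂ ∧ ∀ e, e ∈ P ↔ e ∈ P₁ ∨ e ∈ P₂ := by
  obtain ⟨s, t, rfl⟩ := List.append_of_mem hv
  obtain ⟨h1, h2⟩ := isPath_append_cons.1 h
  exact ⟨_, _, h1, h2, by simp; tauto⟩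

theorem IsPath.trans {a b v : E} {P Q : List E} (hP : G.IsPath a v P) (hQ : G.IsPath v b Q) :
    ∃ R, G.IsPath a b R ∧ ∀ e, e ∈ R ↔ e ∈ P ∨ e ∈ Q := by
  obtain ⟨s, rfl⟩ := hP.exists_eq_concat
  obtain ⟨t, rfl⟩ := hQ.exists_eq_cons
  exact ⟨_, isPath_append_cons.2 ⟨hP, hQ⟩, by simp; tauto⟩

theorem Reaches.trans {a b c : E} : G.Reaches a b → G.Reaches b c → G.Reaches a c :=
  fun ⟨_, hP⟩ ⟨_, hQ⟩ => let ⟨R, hR, _⟩ := hP.trans hQ; ⟨R, hR⟩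

theorem Reaches.antisymm {a b : E} : G.Reaches a b → G.Reaches b a → a = b := by
  rintro ⟨P, hP⟩ ⟨Q, hQ⟩
  obtain ⟨s, rfl⟩ := hP.exists_eq_concat
  obtain ⟨t, rfl⟩ := hQ.exists_eq_cons
  have hR := isPath_append_cons.2 ⟨hP, hQ⟩
  obtain ⟨u, hu⟩ := hR.exists_eq_cons
  cases s with
  | nil => simpa using hP.1.symm
  | cons c s =>
    obtain rfl : c = a := (List.cons.inj hu).1
    have hnd := IsPath.nodup G hR
    -- The closed walk through `b` ends at its first edge.
    exact absurd rfl ((List.nodup_append.1 hnd).2.2 c (by simp) c hQ.right_mem)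

theorem IsPath.reaches_of_mem {a b v : E} {P : List E} (h : G.IsPath a b P) (hv : v ∈ P) :
    G.Reaches a v ∧ G.Reaches v b :=
  let ⟨_, _, h1, h2, _⟩ := h.split hv
  ⟨⟨_, h1⟩, ⟨_, h2⟩⟩

variable (G)

/-- A nonempty set of edges of a finite acyclic network has an edge that reaches no other edge of
the set. -/
theorem exists_last [Finite E] (S : Set E) (hS : S.Nonempty) :
    ∃ v ∈ S, ∀ w ∈ S, G.Reaches v w → w = v := by
  let r : E → E → Prop := fun w v => G.Reaches v w ∧ w ≠ v
  have : IsTrans E r := ⟨fun a b c hab hbc => ⟨hbc.1.trans hab.1, by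
    rintro rfl
    exact hab.2 (Reaches.antisymm hbc.1 hab.1)⟩⟩
  have : Std.Irrefl r := ⟨fun a h => h.2 rfl⟩
  obtain ⟨v, hv, hmin⟩ := (Finite.wellFounded_of_trans_of_irrefl r).has_min S hS
  exact ⟨v, hv, fun w hw hvw => by_contra fun hne => hmin w hw ⟨hvw, hne⟩⟩

/-- A nonempty set of edges of a finite acyclic network has an edge that is reached from no other
edge of the set. -/
theorem exists_first [Finite E] (S : Set E) (hS : S.Nonempty) :
    ∃ v ∈ S, ∀ w ∈ S, G.Reaches w v → w = v := by
  let r : E → E → Prop := fun w v => G.Reaches w v ∧ w ≠ v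
  have : IsTrans E r := ⟨fun a b c hab hbc => ⟨hab.1.trans hbc.1, by
    rintro rfl
    exact hab.2 (Reaches.antisymm hab.1 hbc.1)⟩⟩
  have : Std.Irrefl r := ⟨fun a h => h.2 rfl⟩
  obtain ⟨v, hv, hmin⟩ := (Finite.wellFounded_of_trans_of_irrefl r).has_min S hS
  exact ⟨v, hv, fun w hw hvw => by_contra fun hne => hmin w hw ⟨hvw, hne⟩⟩

/-! ### Path polynomials -/

/-- The sum of the path monomials over all directed paths from `a` to `b`. -/
noncomputable def pathSum [Finite E] (a b : E) : MvPolynomial (E × E) (ZMod 2) :=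
  ∑ P ∈ (G.finite_paths a b).toFinset, pathMonomial P

variable {G}

/-- Distinct paths have distinct monomials, so no cancellation occurs in a sum of path
monomials. -/
theorem eq_empty_of_sum_pathMonomial_eq_zero {a b : E} {S : Finset (List E)}
    (hS : ∀ P ∈ S, G.IsPath a b P) (h : ∑ P ∈ S, pathMonomial P = 0) : S = ∅ := by
  classical
  by_contra hne
  obtain ⟨P, hP⟩ := Finset.nonempty_iff_ne_empty.2 hne
  obtain ⟨s, hs⟩ := exists_pathMonomial_eq_monomial P
  have hc := congrArg (coeff s) h
  rw [coeff_sum, Finset.sum_eq_single_of_mem P hP, hs] at hc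
  · simp at hc
  · intro Q hQ hQP
    obtain ⟨t, ht⟩ := exists_pathMonomial_eq_monomial Q
    rw [ht, coeff_monomial, if_neg]
    rintro rfl
    obtain ⟨P', rfl⟩ := (hS P hP).exists_eq_cons
    obtain ⟨Q', rfl⟩ := (hS Q hQ).exists_eq_cons
    exact hQP (congrArg _ (eq_of_pathMonomial_eq (IsPath.nodup G (hS _ hQ))
      (IsPath.nodup G (hS _ hP)) (ht.trans hs.symm)))

theorem natDegree_tagVars_pathSum_le [Finite E] {I : Set (E × E)} {a b : E} {n : ℕ}
    (h : ∀ P, G.IsPath a b P → (tagVars I (pathMonomial P)).natDegree ≤ n) :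
    (tagVars I (G.pathSum a b)).natDegree ≤ n := by
  rw [pathSum, map_sum]
  exact Polynomial.natDegree_sum_le_of_forall_le _ _ fun P hP => h P (by simpa using hP)

theorem pathSum_ne_zero [Finite E] {a b : E} (h : G.Reaches a b) : G.pathSum a b ≠ 0 := by
  obtain ⟨P, hP⟩ := h
  intro h0
  have := eq_empty_of_sum_pathMonomial_eq_zero (fun P hP => by simpa using hP) h0
  have hmem : P ∈ (G.finite_paths a b).toFinset := by simpa using hP
  simp [this] at hmem

theorem IsPath.mem_tail_iff {a b v : E} {P : List E} (h : G.IsPath a b P) :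
    v ∈ P.tail ↔ v ∈ P ∧ v ≠ a := by
  have hnd := IsPath.nodup G h
  obtain ⟨t, rfl⟩ := h.exists_eq_cons
  rw [List.nodup_cons] at hnd
  simp only [List.tail_cons, List.mem_cons]
  constructor
  · exact fun hv => ⟨.inr hv, fun hva => hnd.1 (hva ▸ hv)⟩
  · tauto

theorem IsPath.mem_dropLast_iff {a b v : E} {P : List E} (h : G.IsPath a b P) :
    v ∈ P.dropLast ↔ v ∈ P ∧ v ≠ b := by
  have hnd := IsPath.nodup G h
  obtain ⟨t, rfl⟩ := h.exists_eq_concat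
  rw [List.nodup_append] at hnd
  simp only [List.dropLast_concat, List.mem_append, List.mem_singleton]
  constructor
  · exact fun hv => ⟨.inl hv, fun hva => hnd.2.2 v hv b (by simp) hva⟩
  · tauto

open Classical in
theorem killVars_arcsInto_pathSum [Finite E] {a b v : E} (hv : v ≠ a) :
    killVars (arcsInto v) (G.pathSum a b) =
      ∑ P ∈ (G.finite_paths a b).toFinset with v ∉ P, pathMonomial P := by
  rw [pathSum, map_sum, Finset.sum_filter]
  refine Finset.sum_congr rfl fun P hP => ?_
  replace hP : G.IsPath a b P := by simpa using hP
  split_ifs with h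
  · exact killVars_arcsInto_eq_zero (hP.mem_tail_iff.2 ⟨h, hv⟩)
  · exact killVars_arcsInto fun h' => h (List.mem_of_mem_tail h')

open Classical in
theorem killVars_arcsFrom_pathSum [Finite E] {a b v : E} (hv : v ≠ b) :
    killVars (arcsFrom v) (G.pathSum a b) =
      ∑ P ∈ (G.finite_paths a b).toFinset with v ∉ P, pathMonomial P := by
  rw [pathSum, map_sum, Finset.sum_filter]
  refine Finset.sum_congr rfl fun P hP => ?_
  replace hP : G.IsPath a b P := by simpa using hP
  split_ifs with h
  · exact killVars_arcsFrom_eq_zero (hP.mem_dropLast_iff.2 ⟨h, hv⟩)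
  · exact killVars_arcsFrom fun h' => h (List.mem_of_mem_dropLast h')

open Classical in
theorem sum_avoiding_eq_zero_iff [Finite E] {a b v : E} :
    ∑ P ∈ (G.finite_paths a b).toFinset with v ∉ P, pathMonomial P = 0 ↔ G.Bottleneck a b v := by
  constructor
  · intro h P hP
    have := eq_empty_of_sum_pathMonomial_eq_zero (G := G) (a := a) (b := b)
      (fun P hP => by simpa using (Finset.mem_filter.1 hP).1) h
    by_contra hv
    have hmem : P ∈ {P ∈ (G.finite_paths a b).toFinset | v ∉ P} :=
      Finset.mem_filter.2 ⟨by simpa using hP, hv⟩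
    simp [this] at hmem
  · intro h
    rw [Finset.filter_eq_empty_iff.2 fun P hP hv => hv (h P (by simpa using hP)), Finset.sum_empty]

theorem killVars_arcsInto_pathSum_eq_zero_iff [Finite E] {a b v : E} (h : G.Reaches a b) :
    killVars (arcsInto v) (G.pathSum a b) = 0 ↔ G.Bottleneck a b v ∧ v ≠ a := by
  by_cases hv : v = a
  · subst hv
    have : killVars (arcsInto v) (G.pathSum v b) = G.pathSum v b := by
      rw [pathSum, map_sum]
      refine Finset.sum_congr rfl fun P hP => killVars_arcsInto fun h' => ?_
      replace hP : G.IsPath v b P := by simpa using hP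
      exact (hP.mem_tail_iff.1 h').2 rfl
    simp [this, pathSum_ne_zero h]
  · rw [killVars_arcsInto_pathSum hv, sum_avoiding_eq_zero_iff]
    simp [hv]

theorem killVars_arcsFrom_pathSum_eq_zero_iff [Finite E] {a b v : E} (h : G.Reaches a b) :
    killVars (arcsFrom v) (G.pathSum a b) = 0 ↔ G.Bottleneck a b v ∧ v ≠ b := by
  by_cases hv : v = b
  · subst hv
    have : killVars (arcsFrom v) (G.pathSum a v) = G.pathSum a v := by
      rw [pathSum, map_sum]
      refine Finset.sum_congr rfl fun P hP => killVars_arcsFrom fun h' => ?_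
      replace hP : G.IsPath a v P := by simpa using hP
      exact (hP.mem_dropLast_iff.1 h').2 rfl
    simp [this, pathSum_ne_zero h]
  · rw [killVars_arcsFrom_pathSum hv, sum_avoiding_eq_zero_iff]
    simp [hv]

/-- Path polynomials factor at bottlenecks. -/
theorem Bottleneck.pathSum_eq_mul [Finite E] {a b v : E} (h : G.Bottleneck a b v) :
    G.pathSum a b = G.pathSum a v * G.pathSum v b := by
  unfold pathSum
  rw [Finset.sum_mul_sum, ← Finset.sum_product']
  symm
  refine Finset.sum_bij (fun x _ => x.1 ++ x.2.tail) ?_ ?_ ?_ ?_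
  · rintro ⟨P, Q⟩ hx
    obtain ⟨hP, hQ⟩ : G.IsPath a v P ∧ G.IsPath v b Q := by simpa using hx
    obtain ⟨s, rfl⟩ := hP.exists_eq_concat
    obtain ⟨t, rfl⟩ := hQ.exists_eq_cons
    simpa using isPath_append_cons.2 ⟨hP, hQ⟩
  · rintro ⟨P, Q⟩ hx ⟨P', Q'⟩ hx' heq
    obtain ⟨hP, hQ⟩ : G.IsPath a v P ∧ G.IsPath v b Q := by simpa using hx
    obtain ⟨hP', hQ'⟩ : G.IsPath a v P' ∧ G.IsPath v b Q' := by simpa using hx'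
    obtain ⟨s, rfl⟩ := hP.exists_eq_concat
    obtain ⟨t, rfl⟩ := hQ.exists_eq_cons
    obtain ⟨s', rfl⟩ := hP'.exists_eq_concat
    obtain ⟨t', rfl⟩ := hQ'.exists_eq_cons
    have hs : v ∉ s := fun hv => by
      have := IsPath.nodup G hP
      exact (List.nodup_append.1 this).2.2 v hv v (by simp) rfl
    have hs' : v ∉ s' := fun hv => by
      have := IsPath.nodup G hP'
      exact (List.nodup_append.1 this).2.2 v hv v (by simp) rfl
    have heq' : s ++ v :: t = s' ++ v :: t' := by simpa using heq
    have hss : s = s' := by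
      rcases List.append_eq_append_iff.1 heq' with ⟨u, h1, h2⟩ | ⟨u, h1, h2⟩ <;> cases u
      · simpa using h1.symm
      · simp only [List.cons_append, List.cons.injEq] at h2
        exact absurd (by simp [h1, h2.1]) hs'
      · simpa using h1
      · simp only [List.cons_append, List.cons.injEq] at h2
        exact absurd (by simp [h1, h2.1]) hs
    subst hss
    simpa using heq'
  · intro P hP
    replace hP : G.IsPath a b P := by simpa using hP
    obtain ⟨s, t, rfl⟩ := List.append_of_mem (h P hP)
    exact ⟨(s ++ [v], v :: t), by simpa using isPath_append_cons.1 hP, by simp⟩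
  · rintro ⟨P, Q⟩ hx
    obtain ⟨hP, hQ⟩ : G.IsPath a v P ∧ G.IsPath v b Q := by simpa using hx
    obtain ⟨s, rfl⟩ := hP.exists_eq_concat
    obtain ⟨t, rfl⟩ := hQ.exists_eq_cons
    simpa using (pathMonomial_append s t v).symm

/-! ### Common factors of path polynomials -/

theorem pathSum_self [Finite E] (a : E) : G.pathSum a a = 1 := by
  have : (G.finite_paths a a).toFinset = {[a]} := by
    ext P
    rw [Set.Finite.mem_toFinset, Finset.mem_singleton]
    refine ⟨fun hP => ?_, fun hP => hP ▸ isPath_singleton a⟩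
    obtain ⟨t, rfl⟩ := IsPath.exists_eq_cons hP
    have hnd := (List.nodup_cons.1 (IsPath.nodup G hP)).1
    cases t with
    | nil => rfl
    | cons b t =>
      have hlast := hP.2.1
      rw [List.getLast?_cons_cons] at hlast
      exact absurd (List.mem_of_getLast? hlast) hnd
  rw [pathSum, this, Finset.sum_singleton, pathMonomial_singleton]

theorem not_head_eq_tail (v : E) : G.head v ≠ G.tail v := fun h =>
  G.acyclic _ (.single ⟨v, rfl, h⟩)

theorem reaches_of_head_eq_tail {v w : E} (h : G.head v = G.tail w) : G.Reaches v w :=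
  ⟨[v, w], by simp [IsPath, h]⟩

/-- A divisor of a path polynomial involves only pairs of consecutive edges. -/
theorem head_eq_tail_of_mem_vars [Finite E] {a b : E} (hab : G.Reaches a b)
    {h : MvPolynomial (E × E) (ZMod 2)} (hdvd : h ∣ G.pathSum a b) {x : E × E} (hx : x ∈ h.vars) :
    G.head x.1 = G.tail x.2 := by
  obtain ⟨k, hk⟩ := hdvd
  have hdeg : (tagVars {x : E × E | G.head x.1 ≠ G.tail x.2} (h * k)).natDegree = 0 := by
    rw [← hk, ← Nat.le_zero]
    exact natDegree_tagVars_pathSum_le fun P hP =>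
      (tagVars_pathMonomial_of_forall fun x hx => not_not.2
        (rel_of_mem_zip_tail hP.2.2 hx)).le
  have := killVars_left_eq_self (hk ▸ pathSum_ne_zero hab) hdeg
  rw [← this] at hx
  exact not_not.1 (notMem_of_mem_vars_killVars hx)

theorem vars_nonempty_of_not_isUnit {h : MvPolynomial (E × E) (ZMod 2)} (h0 : h ≠ 0)
    (hu : ¬ IsUnit h) : h.vars.Nonempty := by
  rw [Finset.nonempty_iff_ne_empty, Ne, vars_eq_empty_iff_eq_C]
  intro hv
  rw [hv] at h0 hu
  exact hu ((IsUnit.mk0 (coeff 0 h) fun h => h0 (by rw [h, C_0])).map C)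

/-- A nonconstant divisor of a path polynomial vanishes when the pairs entering some edge `v` are
killed: `v` is the last edge entered by a pair that the divisor involves. -/
theorem exists_killVars_arcsInto_eq_zero [Finite E] {a b : E} (hab : G.Reaches a b)
    {h : MvPolynomial (E × E) (ZMod 2)} (hdvd : h ∣ G.pathSum a b) (hu : ¬ IsUnit h) :
    ∃ v, killVars (arcsInto v) h = 0 := by
  have hvars := fun x => head_eq_tail_of_mem_vars (x := x) hab hdvd
  obtain ⟨k, hk⟩ := hdvd
  have hne : h * k ≠ 0 := hk ▸ pathSum_ne_zero hab
  obtain ⟨x, hx⟩ := vars_nonempty_of_not_isUnit (left_ne_zero_of_mul hne) hu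
  obtain ⟨v, ⟨e, he⟩, hlast⟩ := G.exists_last {v | ∃ e, (e, v) ∈ h.vars} ⟨x.2, x.1, hx⟩
  refine ⟨v, ?_⟩
  have hI : killVars (arcsInto v) h ≠ h := by
    intro heq
    rw [← heq] at he
    exact notMem_of_mem_vars_killVars he (Eq.refl v)
  have hO : killVars (arcsFrom v) h = h := by
    refine killVars_eq_self fun y hy (hyv : y.1 = v) => ?_
    have hadj := hvars y hy
    have := hlast y.2 ⟨y.1, hy⟩ (reaches_of_head_eq_tail (hyv ▸ hadj))
    rw [hyv, this] at hadj
    exact not_head_eq_tail v hadj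
  have hdeg : (tagVars (arcsInto v) (h * k)).natDegree ≤ 1 := by
    rw [← hk]
    exact natDegree_tagVars_pathSum_le fun P hP =>
      natDegree_tagVars_arcsInto_le (IsPath.nodup G hP) v
  have hva : v ≠ a := by
    rintro rfl
    refine hI (killVars_left_eq_self hne ?_)
    rw [← hk, ← Nat.le_zero]
    refine natDegree_tagVars_pathSum_le fun P hP => (tagVars_pathMonomial_of_forall
      fun x hx hxa => ?_).le
    exact (hP.mem_tail_iff.1 (List.of_mem_zip hx).2).2 hxa
  refine killVars_left_eq_zero hne hdeg hI hO ?_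
  rw [← hk]
  by_cases hvb : v = b
  · exact .inl ((killVars_arcsInto_pathSum_eq_zero_iff hab).2
      ⟨fun P hP => hvb ▸ hP.right_mem, hva⟩)
  · right
    rw [killVars_arcsFrom_pathSum hvb, killVars_arcsInto_pathSum hva]

/-- A nonconstant divisor of a path polynomial vanishes when the pairs leaving some edge `v` are
killed: `v` is the first edge left by a pair that the divisor involves. -/
theorem exists_killVars_arcsFrom_eq_zero [Finite E] {a b : E} (hab : G.Reaches a b)
    {h : MvPolynomial (E × E) (ZMod 2)} (hdvd : h ∣ G.pathSum a b) (hu : ¬ IsUnit h) :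
    ∃ v, killVars (arcsFrom v) h = 0 := by
  have hvars := fun x => head_eq_tail_of_mem_vars (x := x) hab hdvd
  obtain ⟨k, hk⟩ := hdvd
  have hne : h * k ≠ 0 := hk ▸ pathSum_ne_zero hab
  obtain ⟨x, hx⟩ := vars_nonempty_of_not_isUnit (left_ne_zero_of_mul hne) hu
  obtain ⟨v, ⟨e, he⟩, hfirst⟩ := G.exists_first {v | ∃ e, (v, e) ∈ h.vars} ⟨x.1, x.2, hx⟩
  refine ⟨v, ?_⟩
  have hI : killVars (arcsFrom v) h ≠ h := by
    intro heq
    rw [← heq] at he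
    exact notMem_of_mem_vars_killVars he (Eq.refl v)
  have hO : killVars (arcsInto v) h = h := by
    refine killVars_eq_self fun y hy (hyv : y.2 = v) => ?_
    have hadj := hvars y hy
    have := hfirst y.1 ⟨y.2, hy⟩ (reaches_of_head_eq_tail (hyv ▸ hadj))
    rw [hyv, this] at hadj
    exact not_head_eq_tail v hadj
  have hdeg : (tagVars (arcsFrom v) (h * k)).natDegree ≤ 1 := by
    rw [← hk]
    exact natDegree_tagVars_pathSum_le fun P hP =>
      natDegree_tagVars_arcsFrom_le (IsPath.nodup G hP) v
  have hvb : v ≠ b := by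
    rintro rfl
    refine hI (killVars_left_eq_self hne ?_)
    rw [← hk, ← Nat.le_zero]
    refine natDegree_tagVars_pathSum_le fun P hP => (tagVars_pathMonomial_of_forall
      fun x hx hxa => ?_).le
    exact (hP.mem_dropLast_iff.1 (mem_dropLast_of_mem_zip_tail hx)).2 hxa
  refine killVars_left_eq_zero hne hdeg hI hO ?_
  rw [← hk]
  by_cases hva : v = a
  · exact .inl ((killVars_arcsFrom_pathSum_eq_zero_iff hab).2
      ⟨fun P hP => hva ▸ hP.left_mem, hvb⟩)
  · right
    rw [killVars_arcsFrom_pathSum hvb, killVars_arcsInto_pathSum hva]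

theorem Bottleneck.reaches {a b v : E} (h : G.Bottleneck a b v) (hab : G.Reaches a b) :
    G.Reaches a v ∧ G.Reaches v b :=
  let ⟨P, hP⟩ := hab
  hP.reaches_of_mem (h P hP)

theorem Bottleneck.trans_left {a b v w : E} (hv : G.Bottleneck a b v) (hw : G.Bottleneck v b w) :
    G.Bottleneck a b w := fun P hP =>
  let ⟨_, _, _, h2, hP'⟩ := hP.split (hv P hP)
  (hP' w).2 (.inr (hw _ h2))

theorem Bottleneck.trans_right {a b v w : E} (hv : G.Bottleneck a b v)
    (hw : G.Bottleneck a v w) : G.Bottleneck a b w := fun P hP =>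
  let ⟨_, _, h1, _, hP'⟩ := hP.split (hv P hP)
  (hP' w).2 (.inl (hw _ h1))

/-- Beyond the last common bottleneck, the path polynomials to two edges have no common factor. -/
theorem exists_bottleneck_isRelPrime_from [Finite E] {a b c : E} (hb : G.Reaches a b)
    (hc : G.Reaches a c) : ∃ v, G.Bottleneck a b v ∧ G.Bottleneck a c v ∧
      IsRelPrime (G.pathSum v b) (G.pathSum v c) := by
  obtain ⟨v, ⟨hvb, hvc⟩, hlast⟩ := G.exists_last {v | G.Bottleneck a b v ∧ G.Bottleneck a c v}
    ⟨a, fun _ hP => hP.left_mem, fun _ hP => hP.left_mem⟩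
  refine ⟨v, hvb, hvc, fun h hhb hhc => by_contra fun hu => ?_⟩
  have hb' := (hvb.reaches hb).2
  have hc' := (hvc.reaches hc).2
  obtain ⟨w, hw⟩ := exists_killVars_arcsInto_eq_zero hb' hhb hu
  have key : ∀ d, G.Reaches v d → h ∣ G.pathSum v d → G.Bottleneck v d w ∧ w ≠ v :=
    fun d hd ⟨k, hk⟩ => (killVars_arcsInto_pathSum_eq_zero_iff hd).1 <| by
      rw [hk, map_mul, hw, zero_mul]
  obtain ⟨h1, hne⟩ := key b hb' hhb
  exact hne (hlast w ⟨hvb.trans_left h1, hvc.trans_left (key c hc' hhc).1⟩ (h1.reaches hb').1)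

/-- Up to the first common bottleneck, the path polynomials from two edges have no common
factor. -/
theorem exists_bottleneck_isRelPrime_into [Finite E] {a b c : E} (ha : G.Reaches a c)
    (hb : G.Reaches b c) : ∃ v, G.Bottleneck a c v ∧ G.Bottleneck b c v ∧
      IsRelPrime (G.pathSum a v) (G.pathSum b v) := by
  obtain ⟨v, ⟨hva, hvb⟩, hfirst⟩ := G.exists_first {v | G.Bottleneck a c v ∧ G.Bottleneck b c v}
    ⟨c, fun _ hP => hP.right_mem, fun _ hP => hP.right_mem⟩
  refine ⟨v, hva, hvb, fun h hha hhb => by_contra fun hu => ?_⟩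
  have ha' := (hva.reaches ha).1
  have hb' := (hvb.reaches hb).1
  obtain ⟨w, hw⟩ := exists_killVars_arcsFrom_eq_zero ha' hha hu
  have key : ∀ d, G.Reaches d v → h ∣ G.pathSum d v → G.Bottleneck d v w ∧ w ≠ v :=
    fun d hd ⟨k, hk⟩ => (killVars_arcsFrom_pathSum_eq_zero_iff hd).1 <| by
      rw [hk, map_mul, hw, zero_mul]
  obtain ⟨h1, hne⟩ := key a ha' hha
  exact hne (hfirst w ⟨hva.trans_right h1, hvb.trans_right (key b hb' hhb).1⟩ (h1.reaches ha').2)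

/-- A constant path polynomial belongs to a trivial path, since otherwise killing the pairs leaving
the start kills it. -/
theorem eq_of_isUnit_pathSum [Finite E] {a b : E} (hab : G.Reaches a b)
    (h : IsUnit (G.pathSum a b)) : a = b := by
  by_contra hne
  have h0 := (killVars_arcsFrom_pathSum_eq_zero_iff hab).2 ⟨fun _ hP => hP.left_mem, hne⟩
  exact (h.map (killVars (arcsFrom a))).ne_zero h0

/-- A nonconstant path polynomial determines the two ends of its paths, even up to constants: by
mutual divisibility each end is a bottleneck for the other pair of ends. -/
theorem eq_and_eq_of_pathSum_dvd [Finite E] {a b c d : E} (hab : G.Reaches a b)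
    (hcd : G.Reaches c d) (h₁ : G.pathSum a b ∣ G.pathSum c d)
    (h₂ : G.pathSum c d ∣ G.pathSum a b) (hu : ¬ IsUnit (G.pathSum a b)) : a = c ∧ b = d := by
  have hne : ∀ {x y : E}, ¬ IsUnit (G.pathSum x y) → x ≠ y := by
    rintro x _ hu rfl
    exact hu (pathSum_self x ▸ isUnit_one)
  have hab' := hne hu
  have hcd' := hne fun h => hu (isUnit_of_dvd_unit h₁ h)
  have hfrom : ∀ {x y z w : E}, G.Reaches x y → G.Reaches z w → x ≠ y →
      G.pathSum x y ∣ G.pathSum z w → G.Reaches z x := fun {x y z w} hxy hzw hne ⟨k, hk⟩ => by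
    have h0 := (killVars_arcsFrom_pathSum_eq_zero_iff hxy).2 ⟨fun _ hP => hP.left_mem, hne⟩
    have h1 := (killVars_arcsFrom_pathSum_eq_zero_iff hzw (v := x)).1
      (by rw [hk, map_mul, h0, zero_mul])
    exact (h1.1.reaches hzw).1
  have hinto : ∀ {x y z w : E}, G.Reaches x y → G.Reaches z w → x ≠ y →
      G.pathSum x y ∣ G.pathSum z w → G.Reaches y w := fun {x y z w} hxy hzw hne ⟨k, hk⟩ => by
    have h0 := (killVars_arcsInto_pathSum_eq_zero_iff hxy).2 ⟨fun _ hP => hP.right_mem, hne.symm⟩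
    have h1 := (killVars_arcsInto_pathSum_eq_zero_iff hzw (v := y)).1
      (by rw [hk, map_mul, h0, zero_mul])
    exact (h1.1.reaches hzw).2
  exact ⟨Reaches.antisymm (hfrom hcd hab hcd' h₂) (hfrom hab hcd hab' h₁),
    Reaches.antisymm (hinto hab hcd hab' h₁) (hinto hcd hab hcd' h₂)⟩

/-! ### The bottleneck structure forced by `η = 1` -/

/-- If the entries of an off-diagonal `3 × 3` array are coprime along rows and along columns and the
products along the two 3-cycles agree, then opposite entries divide each other. -/
theorem dvd_swap_of_cyclic_eq {R : Type*} [CommMonoid R] [DecompositionMonoid R]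
    {B : Fin 3 → Fin 3 → R}
    (hrow : ∀ i j k, i ≠ j → i ≠ k → j ≠ k → IsRelPrime (B i j) (B i k))
    (hcol : ∀ i j k, j ≠ i → k ≠ i → j ≠ k → IsRelPrime (B j i) (B k i))
    (hB : ∀ i j k, i ≠ j → i ≠ k → j ≠ k → B i k * B j i * B k j = B i j * B j k * B k i)
    {i k : Fin 3} (hik : i ≠ k) : B i k ∣ B k i := by
  obtain ⟨j, hij, hjk⟩ : ∃ j, i ≠ j ∧ j ≠ k := by revert i k; decide
  have h1 : B i k ∣ B i j * (B j k * B k i) := by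
    rw [← mul_assoc, ← hB i j k hij hik hjk, mul_assoc]
    exact dvd_mul_right _ _
  exact (hcol k i j hik hjk hij).dvd_of_dvd_mul_left
    ((hrow i k j hik hij hjk.symm).dvd_of_dvd_mul_left h1)

/-- If the path polynomials between distinct indices satisfy the identity `η = 1`, then there are
edges `f` and `g`, with `g` reachable from `f`, and an index `j` such that every path between
distinct indices passes through `f` unless it starts at `s j`, and through `g` unless it ends at
`t j`. -/
theorem exists_bottlenecks_of_cyclic_eq [Finite E] {s t : Fin 3 → E}
    (hconn : ∀ i j, G.Reaches (s i) (t j))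
    (hcyc : ∀ i j k, i ≠ j → i ≠ k → j ≠ k →
      G.pathSum (s i) (t k) * G.pathSum (s j) (t i) * G.pathSum (s k) (t j) =
        G.pathSum (s i) (t j) * G.pathSum (s j) (t k) * G.pathSum (s k) (t i)) :
    ∃ (j : Fin 3) (f g : E), G.Reaches f g ∧
      (∀ x y, x ≠ y → x ≠ j → G.Bottleneck (s x) (t y) f) ∧
      ∀ x y, x ≠ y → y ≠ j → G.Bottleneck (s x) (t y) g := by
  have hthird : ∀ i : Fin 3, ∃ j k, ∀ x, x ≠ i → x = j ∨ x = k := by decide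
  have hα : ∀ i, ∃ v, (∀ j, i ≠ j → G.Bottleneck (s i) (t j) v) ∧
      ∀ j k, i ≠ j → i ≠ k → j ≠ k → IsRelPrime (G.pathSum v (t j)) (G.pathSum v (t k)) := by
    intro i
    obtain ⟨j, k, hjk⟩ := hthird i
    obtain ⟨v, hj, hk, hrel⟩ := exists_bottleneck_isRelPrime_from (hconn i j) (hconn i k)
    refine ⟨v, fun x hx => ?_, fun x y hx hy hxy => ?_⟩
    · rcases hjk x hx.symm with rfl | rfl <;> assumption
    · rcases hjk x hx.symm with rfl | rfl <;> rcases hjk y hy.symm with rfl | rfl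
      exacts [absurd rfl hxy, hrel, hrel.symm, absurd rfl hxy]
  choose α hα hαrel using hα
  have hαt : ∀ i j, i ≠ j → G.Reaches (α i) (t j) := fun i j hij =>
    ((hα i j hij).reaches (hconn i j)).2
  have hsα : ∀ i, G.Reaches (s i) (α i) := fun i => by
    obtain ⟨j, hij⟩ : ∃ j, i ≠ j := by revert i; decide
    exact ((hα i j hij).reaches (hconn i j)).1
  have hβ : ∀ i, ∃ v, (∀ j, j ≠ i → G.Bottleneck (α j) (t i) v) ∧
      ∀ j k, j ≠ i → k ≠ i → j ≠ k → IsRelPrime (G.pathSum (α j) v) (G.pathSum (α k) v) := by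
    intro i
    obtain ⟨j, k, hij, hik, hjk⟩ : ∃ j k, j ≠ i ∧ k ≠ i ∧ ∀ x, x ≠ i → x = j ∨ x = k := by
      revert i; decide
    obtain ⟨v, hj, hk, hrel⟩ := exists_bottleneck_isRelPrime_into (hαt j i hij) (hαt k i hik)
    refine ⟨v, fun x hx => ?_, fun x y hx hy hxy => ?_⟩
    · rcases hjk x hx with rfl | rfl <;> assumption
    · rcases hjk x hx with rfl | rfl <;> rcases hjk y hy with rfl | rfl
      exacts [absurd rfl hxy, hrel, hrel.symm, absurd rfl hxy]
  choose β hβ hβrel using hβ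
  have hαβ : ∀ i j, i ≠ j → G.Reaches (α i) (β j) := fun i j hij =>
    ((hβ j i hij).reaches (hαt i j hij)).1
  have hβt : ∀ j, G.Reaches (β j) (t j) := fun j => by
    obtain ⟨i, hij⟩ : ∃ i, i ≠ j := by revert j; decide
    exact ((hβ j i hij).reaches (hαt i j hij)).2
  have hsβ : ∀ i j, i ≠ j → G.Bottleneck (s i) (t j) (β j) := fun i j hij =>
    (hα i j hij).trans_left (hβ j i hij)
  have hfac : ∀ i j, i ≠ j → G.pathSum (s i) (t j) =
      G.pathSum (s i) (α i) * G.pathSum (α i) (β j) * G.pathSum (β j) (t j) := fun i j hij => by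
    rw [(hα i j hij).pathSum_eq_mul, (hβ j i hij).pathSum_eq_mul, mul_assoc]
  have hdvd : ∀ i k, i ≠ k → G.pathSum (α i) (β k) ∣ G.pathSum (α k) (β i) := by
    intro i k hik
    refine dvd_swap_of_cyclic_eq (B := fun i j => G.pathSum (α i) (β j)) ?_ hβrel ?_ hik
    · intro i j k hij hik hjk
      refine (hαrel i j k hij hik hjk).of_dvd_left ?_ |>.of_dvd_right ?_
      · rw [(hβ j i hij).pathSum_eq_mul]
        exact dvd_mul_right _ _
      · rw [(hβ k i hik).pathSum_eq_mul]
        exact dvd_mul_right _ _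
    · intro i j k hij hik hjk
      -- Both products contain each `s`-to-`α` factor and each `β`-to-`t` factor exactly once.
      have hne : G.pathSum (s i) (α i) * G.pathSum (s j) (α j) * G.pathSum (s k) (α k) *
          (G.pathSum (β i) (t i) * G.pathSum (β j) (t j) * G.pathSum (β k) (t k)) ≠ 0 := by
        simp only [ne_eq, mul_eq_zero, pathSum_ne_zero, hsα, hβt, or_self, not_false_eq_true]
      refine mul_left_cancel₀ hne ?_
      have h := hcyc i j k hij hik hjk
      rw [hfac i k hik, hfac j i hij.symm, hfac k j hjk.symm, hfac i j hij, hfac j k hjk,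
        hfac k i hik.symm] at h
      linear_combination h
  by_cases hunit : ∀ i k, i ≠ k → IsUnit (G.pathSum (α i) (β k))
  · have heq : ∀ i k, i ≠ k → α i = β k := fun i k hik =>
      eq_of_isUnit_pathSum (hαβ i k hik) (hunit i k hik)
    have h01 := heq 0 1 (by decide)
    have h02 := heq 0 2 (by decide)
    have h12 := heq 1 2 (by decide)
    have h20 := heq 2 0 (by decide)
    have h21 := heq 2 1 (by decide)
    have hα0 : ∀ i, α i = α 0 := by
      intro i
      fin_cases i
      exacts [rfl, h12.trans h02.symm, h21.trans h01.symm]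
    have hβ0 : ∀ i, β i = α 0 := by
      intro i
      fin_cases i
      exacts [h20.symm.trans (hα0 2), h01.symm, h02.symm]
    exact ⟨0, α 0, α 0, ⟨_, isPath_singleton _⟩, fun x y hxy _ => hα0 x ▸ hα x y hxy,
      fun x y hxy _ => hβ0 y ▸ hsβ x y hxy⟩
  · push Not at hunit
    obtain ⟨i, k, hik, hu⟩ := hunit
    obtain ⟨hα', hβ'⟩ := eq_and_eq_of_pathSum_dvd (hαβ i k hik) (hαβ k i hik.symm)
      (hdvd i k hik) (hdvd k i hik.symm) hu
    obtain ⟨j, hj⟩ := (by decide : ∀ i k : Fin 3, i ≠ k → ∃ j, ∀ x, x ≠ j → x = i ∨ x = k) i k hik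
    refine ⟨j, α i, β k, hαβ i k hik, fun x y hxy hxj => ?_, fun x y hxy hyj => ?_⟩
    · rcases hj x hxj with rfl | rfl
      · exact hα x y hxy
      · exact hα' ▸ hα x y hxy
    · rcases hj y hyj with rfl | rfl
      · exact hβ' ▸ hsβ x y hxy
      · exact hsβ x y hxy

/-! ### Disjoint paths -/

theorem pathSum_mul_comm_of_bottleneck [Finite E] {a a' b b' v : E} (h₁ : G.Bottleneck a b v)
    (h₂ : G.Bottleneck a' b' v) (h₃ : G.Bottleneck a' b v) (h₄ : G.Bottleneck a b' v) :
    G.pathSum a b * G.pathSum a' b' = G.pathSum a' b * G.pathSum a b' := by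
  rw [h₁.pathSum_eq_mul, h₂.pathSum_eq_mul, h₃.pathSum_eq_mul, h₄.pathSum_eq_mul]
  ring

/-- With bottlenecks `f` and `g` as in `exists_bottlenecks_of_cyclic_eq`, non-vanishing of the minors
that correspond to `p₁`, `p₂`, `p₃` yields paths from `s i` to `t i` that are pairwise disjoint. -/
theorem exists_disjoint_paths [Finite E] {s t : Fin 3 → E} (hconn : ∀ i j, G.Reaches (s i) (t j))
    {j : Fin 3} {f g : E} (hfg : G.Reaches f g)
    (hf : ∀ x y, x ≠ y → x ≠ j → G.Bottleneck (s x) (t y) f)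
    (hg : ∀ x y, x ≠ y → y ≠ j → G.Bottleneck (s x) (t y) g)
    (hminor : ∀ i j k, i ≠ j → i ≠ k → j ≠ k →
      G.pathSum (s i) (t i) * G.pathSum (s j) (t k) ≠
        G.pathSum (s j) (t i) * G.pathSum (s i) (t k)) :
    ∃ P : Fin 3 → List E, (∀ i, G.IsPath (s i) (t i) (P i)) ∧
      ∀ i j, i ≠ j → ∀ e ∈ P i, e ∉ P j := by
  have havoid : ∀ x, x ≠ j → ∃ P, G.IsPath (s x) (t x) P ∧ f ∉ P ∧ g ∉ P := by
    intro x hxj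
    obtain ⟨y, hxy, hyj⟩ := (by decide : ∀ x j : Fin 3, ∃ y, x ≠ y ∧ j ≠ y) x j
    have hnot : ¬ G.Bottleneck (s x) (t x) g := fun h => hminor x j y hxj hxy hyj <|
      pathSum_mul_comm_of_bottleneck h (hg j y hyj hyj.symm) (hg j x hxj.symm hxj)
        (hg x y hxy hyj.symm)
    obtain ⟨P, hP, hgP⟩ : ∃ P, G.IsPath (s x) (t x) P ∧ g ∉ P := by
      simpa [Bottleneck] using hnot
    refine ⟨P, hP, fun hfP => ?_, hgP⟩
    -- Enter the path from `s y` at `f`: then `g` comes before `f`.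
    obtain ⟨Q₁, Q₂, -, hQ₂, hQ⟩ := hP.split hfP
    obtain ⟨R, hR⟩ := hconn y x
    obtain ⟨R₁, R₂, hR₁, -, -⟩ := hR.split (hf y x hxy.symm hyj.symm R hR)
    obtain ⟨T, hT, hTmem⟩ := hR₁.trans hQ₂
    have hgR : g ∈ R₁ := ((hTmem g).1 (hg y x hxy.symm hxj T hT)).resolve_right
      fun h => hgP ((hQ g).2 (.inr h))
    have : f = g := Reaches.antisymm hfg (hR₁.reaches_of_mem hgR).2
    exact hgP (this ▸ hfP)
  have hex : ∀ x, ∃ P, G.IsPath (s x) (t x) P ∧ (x ≠ j → f ∉ P ∧ g ∉ P) ∧ (f = g → f ∉ P) := by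
    intro x
    by_cases hxj : x = j
    · by_cases hfg' : f = g
      · obtain ⟨y, z, hxy, hxz, hyz⟩ :=
          (by decide : ∀ x : Fin 3, ∃ y z, x ≠ y ∧ x ≠ z ∧ y ≠ z) x
        have hnot : ¬ G.Bottleneck (s x) (t x) f := fun h => hminor x y z hxy hxz hyz <|
          pathSum_mul_comm_of_bottleneck h (hf y z hyz (hxj ▸ hxy.symm))
            (hf y x hxy.symm (hxj ▸ hxy.symm)) (hfg' ▸ hg x z hxz (hxj ▸ hxz.symm))
        obtain ⟨P, hP, hfP⟩ : ∃ P, G.IsPath (s x) (t x) P ∧ f ∉ P := by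
          simpa [Bottleneck] using hnot
        exact ⟨P, hP, fun h => absurd hxj h, fun _ => hfP⟩
      · obtain ⟨P, hP⟩ := hconn x x
        exact ⟨P, hP, fun h => absurd hxj h, fun h => absurd h hfg'⟩
    · obtain ⟨P, hP, h⟩ := havoid x hxj
      exact ⟨P, hP, fun _ => h, fun _ => h.1⟩
  choose P hP hPj hPfg using hex
  have hdisj : ∀ x y, x ≠ y → y ≠ j → ∀ e ∈ P x, e ∉ P y := by
    intro x y hxy hyj e hex hey
    obtain ⟨X₁, X₂, hX₁, hX₂, hX⟩ := (hP x).split hex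
    obtain ⟨Y₁, Y₂, hY₁, hY₂, hY⟩ := (hP y).split hey
    -- Switching paths at `e` shows that `g` comes before `e` and `f` comes after `e`.
    obtain ⟨T, hT, hTmem⟩ := hX₁.trans hY₂
    have hgX : g ∈ X₁ := ((hTmem g).1 (hg x y hxy hyj T hT)).resolve_right
      fun h => (hPj y hyj).2 ((hY g).2 (.inr h))
    obtain ⟨U, hU, hUmem⟩ := hY₁.trans hX₂
    have hfX : f ∈ X₂ := ((hUmem f).1 (hf y x hxy.symm hyj U hU)).resolve_left
      fun h => (hPj y hyj).1 ((hY f).2 (.inl h))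
    have hgf : G.Reaches g f := (hX₁.reaches_of_mem hgX).2.trans (hX₂.reaches_of_mem hfX).1
    exact hPfg x (Reaches.antisymm hfg hgf) ((hX f).2 (.inr hfX))
  refine ⟨P, hP, fun x y hxy e hex hey => ?_⟩
  by_cases hyj : y = j
  · exact hdisj y x hxy.symm (fun h => hxy (h.trans hyj.symm)) e hey hex
  · exact hdisj x y hxy hyj e hex hey

/-! ### The routing scheme of disjoint paths -/

theorem IsPath.eq_or_exists_mem {a b e : E} {P : List E} (h : G.IsPath a b P) (he : e ∈ P) :
    e = a ∨ ∃ e' ∈ P, G.head e' = G.tail e := by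
  obtain ⟨s, t, rfl⟩ := List.append_of_mem he
  rcases List.eq_nil_or_concat s with rfl | ⟨s, e', rfl⟩
  · left
    simpa using h.1
  · right
    refine ⟨e', by simp, ?_⟩
    have := h.2.2
    rw [List.concat_eq_append, List.append_assoc, List.singleton_append,
      List.isChain_append_cons_cons] at this
    exact this.2.1

/-- Disjoint paths give the routing scheme over one slot in which the edges of each path carry the
packet of its session. -/
theorem exists_routingScheme_of_disjoint_paths {P : Fin 3 → List E}
    (hP : ∀ i, G.IsPath (G.σ i) (G.τ i) (P i)) (hdisj : ∀ i j, i ≠ j → ∀ e ∈ P i, e ∉ P j) :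
    ∃ r : G.RoutingScheme 1 (fun _ => 1), ∀ t e pkt, r.carry t e = some pkt ↔ e ∈ P pkt.1 := by
  classical
  let carry : Fin 1 → E → Option (Σ _ : Fin 3, Fin 1) := fun _ e =>
    if h : ∃ i, e ∈ P i then some ⟨h.choose, 0⟩ else none
  have hcarry : ∀ t e pkt, carry t e = some pkt ↔ e ∈ P pkt.1 := by
    rintro t e ⟨i, n⟩
    constructor
    · intro h
      by_cases hex : ∃ i, e ∈ P i
      · simp only [carry, dif_pos hex, Option.some.injEq] at h
        have hi : hex.choose = i := congrArg Sigma.fst h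
        exact hi ▸ hex.choose_spec
      · simp [carry, dif_neg hex] at h
    · intro h
      have hex : ∃ i, e ∈ P i := ⟨i, h⟩
      have hi : hex.choose = i := by_contra fun hne => hdisj _ _ hne e hex.choose_spec h
      simp only [carry, dif_pos hex, hi, Subsingleton.elim n 0]
  refine ⟨⟨carry, fun t e pkt h => ?_, fun pkt => ?_⟩, hcarry⟩
  · rcases (hP pkt.1).eq_or_exists_mem ((hcarry t e pkt).1 h) with he | ⟨e', he', hadj⟩
    · exact .inl he
    · exact .inr ⟨e', hadj, (hcarry t e' pkt).2 he'⟩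
  · exact ⟨0, (hcarry 0 _ pkt).2 (hP pkt.1).right_mem⟩

theorem fin_three_perm : ∀ i j k : Fin 3, i ≠ j → i ≠ k → j ≠ k →
    (i = 0 ∧ j = 1 ∧ k = 2) ∨ (i = 1 ∧ j = 2 ∧ k = 0) ∨ (i = 2 ∧ j = 0 ∧ k = 1) ∨
      (i = 0 ∧ j = 2 ∧ k = 1) ∨ (i = 2 ∧ j = 1 ∧ k = 0) ∨ (i = 1 ∧ j = 0 ∧ k = 2) := by
  decide

end SISOScenario

theorem mainTheorem11 {V E : Type*} [Finite E] (G : SISOScenario V E)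
    (hconn : G.FullyConnected) (hη : G.η = 1)
    (hp₁ : G.p₁ ≠ 1) (hp₂ : G.p₂ ≠ 1) (hp₃ : G.p₃ ≠ 1) :
    G.RoutingAchieves (fun _ => 1) ∧
    ∃ P : Fin 3 → List E,
      (∀ i, G.IsPath (G.σ i) (G.τ i) (P i)) ∧
      (∀ i j, i ≠ j → ∀ e ∈ P i, e ∉ P j) ∧
      ∃ r : G.RoutingScheme 1 (fun _ => 1),
        ∀ t e pkt, r.carry t e = some pkt ↔ e ∈ P pkt.1 := by
  have hm : ∀ i j, G.m i j = algebraMap (MvPolynomial (E × E) (ZMod 2)) _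
    (G.pathSum (G.σ i) (G.τ j)) := fun _ _ => rfl
  have hne : ∀ i j, G.pathSum (G.σ i) (G.τ j) ≠ 0 := fun i j =>
    SISOScenario.pathSum_ne_zero (hconn i j)
  have hinj := IsFractionRing.injective (MvPolynomial (E × E) (ZMod 2))
    (FractionRing (MvPolynomial (E × E) (ZMod 2)))
  have hdiv : ∀ {p q : MvPolynomial (E × E) (ZMod 2)}, q ≠ 0 →
      (algebraMap _ (FractionRing (MvPolynomial (E × E) (ZMod 2))) p / algebraMap _ _ q = 1 ↔
        p = q) := fun hq => by
    rw [div_eq_one_iff_eq (by simpa using hq), hinj.eq_iff]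
  simp only [SISOScenario.η, SISOScenario.p₁, SISOScenario.p₂, SISOScenario.p₃, hm, ← map_mul]
    at hη hp₁ hp₂ hp₃
  rw [hdiv (mul_ne_zero (mul_ne_zero (hne _ _) (hne _ _)) (hne _ _))] at hη
  rw [ne_eq, hdiv (mul_ne_zero (hne _ _) (hne _ _))] at hp₁ hp₂ hp₃
  have hcyc : ∀ i j k : Fin 3, i ≠ j → i ≠ k → j ≠ k →
      G.pathSum (G.σ i) (G.τ k) * G.pathSum (G.σ j) (G.τ i) * G.pathSum (G.σ k) (G.τ j) =
        G.pathSum (G.σ i) (G.τ j) * G.pathSum (G.σ j) (G.τ k) * G.pathSum (G.σ k) (G.τ i) := by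
    intro i j k hij hik hjk
    rcases SISOScenario.fin_three_perm i j k hij hik hjk with ⟨rfl, rfl, rfl⟩ | ⟨rfl, rfl, rfl⟩ |
      ⟨rfl, rfl, rfl⟩ | ⟨rfl, rfl, rfl⟩ | ⟨rfl, rfl, rfl⟩ | ⟨rfl, rfl, rfl⟩
    exacts [by linear_combination hη, by linear_combination hη, by linear_combination hη,
      by linear_combination -hη, by linear_combination -hη, by linear_combination -hη]
  -- By `hcyc`, the minors of a session's row and column with the other two sessions in either order
  -- vanish together.
  have hswap : ∀ i j k : Fin 3, i ≠ j → i ≠ k → j ≠ k →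
      G.pathSum (G.σ i) (G.τ i) * G.pathSum (G.σ j) (G.τ k) =
        G.pathSum (G.σ j) (G.τ i) * G.pathSum (G.σ i) (G.τ k) →
      G.pathSum (G.σ i) (G.τ i) * G.pathSum (G.σ k) (G.τ j) =
        G.pathSum (G.σ k) (G.τ i) * G.pathSum (G.σ i) (G.τ j) := by
    intro i j k hij hik hjk h
    refine mul_left_cancel₀ (mul_ne_zero (hne j i) (hne i k)) ?_
    linear_combination G.pathSum (G.σ i) (G.τ i) * hcyc i j k hij hik hjk +
      G.pathSum (G.σ i) (G.τ j) * G.pathSum (G.σ k) (G.τ i) * h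
  have hminor : ∀ i j k : Fin 3, i ≠ j → i ≠ k → j ≠ k →
      G.pathSum (G.σ i) (G.τ i) * G.pathSum (G.σ j) (G.τ k) ≠
        G.pathSum (G.σ j) (G.τ i) * G.pathSum (G.σ i) (G.τ k) := by
    intro i j k hij hik hjk h
    have h' := hswap i j k hij hik hjk h
    rcases SISOScenario.fin_three_perm i j k hij hik hjk with ⟨rfl, rfl, rfl⟩ | ⟨rfl, rfl, rfl⟩ |
      ⟨rfl, rfl, rfl⟩ | ⟨rfl, rfl, rfl⟩ | ⟨rfl, rfl, rfl⟩ | ⟨rfl, rfl, rfl⟩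
    · exact hp₁ (by linear_combination -h)
    · exact hp₂ (by linear_combination h')
    · exact hp₃ (by linear_combination h')
    · exact hp₁ (by linear_combination -h')
    · exact hp₃ (by linear_combination h)
    · exact hp₂ (by linear_combination h)
  obtain ⟨j, f, g, hfg, hf, hg⟩ := SISOScenario.exists_bottlenecks_of_cyclic_eq
    (s := G.σ) (t := G.τ) hconn hcyc
  obtain ⟨P, hP, hdisj⟩ := SISOScenario.exists_disjoint_paths
    (s := G.σ) (t := G.τ) hconn hfg hf hg hminor
  obtain ⟨r, hr⟩ := SISOScenario.exists_routingScheme_of_disjoint_paths hP hdisj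
  exact ⟨⟨1, fun _ => 1, one_pos, by simp, ⟨r⟩⟩, P, hP, hdisj, r, hr⟩
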